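/- Let $G$ be a finite simple $(c,d)$-regular bipartite graph: its vertex set is partitioned into two sets $U$ and $W$ such that every edge joins $U$ to $W$, every vertex of $U$ has degree $c$, and every vertex of $W$ has degree $d$. Suppose that $G$ contains a cycle, let $g$ be its girth (the length of a shortest cycle), and suppose that $g+4<2g$. For $j\ge 0$ let $N_j$ be the number of cycles of length $j$ in $G$ (counted as subgraphs), let $\Psi_j$ be the number of closed walks of length $j$ in $G$ (with specified initial vertex and direction) that are not themselves cycles but whose set of edges contains all the edges of a cycle, and let $\Omega_j$ be the number of closed walks of length $j$ whose set of edges contains no cycle. Then $$\begin{aligned}\Psi_{g+4}={}&(g+2)\,N_{g+2}\,(g+4)(c+d-2)\\&+gN_g\big[g(c+d-2)^2+(c+d)(c+d-1)\big]\\&+gN_g\Big(2\binom{g/2}{2}\big[(c-1)^2+(d-1)^2\big]+2\big(\tfrac g2\big)^2(c-1)(d-1)\Big)\\&+gN_g\,\tfrac g2\,(c+d)(c+d-2)\\&+gN_g\Big(\big(\tfrac g2+1\big)(c+d-2)(c+d-4)+(c-2)(2d-1)+(d-2)(2c-1)\Big).\end{aligned}$$ Moreover, if $\lambda_1,\dots,\lambda_{|V(G)|}$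 are the eigenvalues of the adjacency matrix of $G$, listed with multiplicity, then $$N_{g+4}=\frac{\sum_{j}\lambda_j^{\,g+4}-\Omega_{g+4}-\Psi_{g+4}}{2(g+4)}.$$ -/

import Mathlib

namespace BiregularCycles

variable {V : Type*}

/-- `G` is a `(c, d)`-regular bipartite graph with parts `U` and `W`: the two parts partition the
vertex set, every edge joins `U` to `W`, every vertex of `U` has degree `c`, and every vertex of
`W` has degree `d`. -/
structure IsBiregularBipartite [Fintype V] (G : SimpleGraph V) [DecidableRel G.Adj]
    (U W : Set V) (c d : ℕ) : Prop where
  isCompl : IsCompl U W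
  bipartite : G.IsBipartiteWith U W
  degree_left : ∀ v ∈ U, G.degree v = c
  degree_right : ∀ v ∈ W, G.degree v = d

/-- The edges traversed by the walk `p` contain all the edges of some cycle of `G`. -/
def ContainsCycle {G : SimpleGraph V} {u v : V} (p : G.Walk u v) : Prop :=
  ∃ (w : V) (q : G.Walk w w), q.IsCycle ∧ q.edges ⊆ p.edges

/-- `N_j`: the number of cycles of length `j`, counted as subgraphs of `G` (that is, without
a starting point or a direction). -/
noncomputable def numCycles (G : SimpleGraph V) (j : ℕ) : ℕ :=
  Set.ncard {H : G.Subgraph |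
    ∃ (v : V) (p : G.Walk v v), p.IsCycle ∧ p.length = j ∧ p.toSubgraph = H}

/-- `Ψ_j`: the number of closed walks of length `j` (with a specified initial vertex and direction)
that are not cycles but whose edges contain a cycle. -/
noncomputable def numClosedWalksWithCycle (G : SimpleGraph V) (j : ℕ) : ℕ :=
  Nat.card {p : Σ v : V, G.Walk v v // p.2.length = j ∧ ¬ p.2.IsCycle ∧ ContainsCycle p.2}

/-- `Ω_j`: the number of closed walks of length `j` whose edges contain no cycle. -/
noncomputable def numClosedCycleFreeWalks (G : SimpleGraph V) (j : ℕ) : ℕ :=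
  Nat.card {p : Σ v : V, G.Walk v v // p.2.length = j ∧ ¬ ContainsCycle p.2}

end BiregularCycles

/-! Cancelling backtracks turns every closed walk into a non-backtracking closed walk from the same
vertex. Below length `2 * g` a walk contains a cycle exactly when its reduction is nontrivial: a
walk that reduces to `nil` uses each edge an even number of times, so covering a cycle would cost at
least `2 * g` steps (`containsCycle_iff_reduce_ne_nil`).

By biregularity, the number of walks of length `n` with a given reduction depends only on `n`, the
reduced length and the side of the initial vertex (`card_reduce_eq`); it satisfies a two-term
recursion, solved for excess 2 and 4 in `liftCount_add_two` and `liftCount_add_four`.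

It remains to count closed non-backtracking walks of lengths `g`, `g + 2` and `g + 4`. One whose
first and last edges differ is a cycle, because a repeated vertex would split it into two closed
non-backtracking pieces, each of length at least `g`. Otherwise the common first and last edge can
be peeled off, which lowers the length by 2 and changes sides (`card_isNonBacktracking_add_two`).

Each cycle of length `k` yields `k` based directed cycles on each side (`card_cycles`). Summing over
both sides and removing the cycles of length `g + 4` gives `Ψ`; the formula for `N` follows because
the trace of the adjacency matrix power counts all closed walks. -/

namespace BiregularCycles

open SimpleGraph Finset

/-! ### Non-backtracking walks and reduction -/

section NonBacktracking

variable {V : Type*} {G : SimpleGraph V} {u v w x y : V}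

/-- A walk is non-backtracking if no two consecutive edges coincide. -/
def IsNonBacktracking (p : G.Walk u v) : Prop :=
  p.edges.IsChain (· ≠ ·)

theorem isNonBacktracking_nil : IsNonBacktracking (Walk.nil : G.Walk u u) := by
  simp [IsNonBacktracking]

theorem isNonBacktracking_cons_nil (h : G.Adj u v) :
    IsNonBacktracking (Walk.cons h Walk.nil) := by
  simp [IsNonBacktracking]

theorem isNonBacktracking_cons_cons (h : G.Adj u v) (h' : G.Adj v w) (p : G.Walk w x) :
    IsNonBacktracking (Walk.cons h (Walk.cons h' p)) ↔
      w ≠ u ∧ IsNonBacktracking (Walk.cons h' p) := by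
  have := h.ne
  simp only [IsNonBacktracking, Walk.edges_cons, List.isChain_cons_cons, ne_eq, Sym2.eq_iff]
  grind

theorem isNonBacktracking_cons (h : G.Adj u v) (p : G.Walk v w) (hp : ¬ p.Nil) :
    IsNonBacktracking (Walk.cons h p) ↔ p.snd ≠ u ∧ IsNonBacktracking p := by
  cases p with
  | nil => simp at hp
  | cons h' p => simp [isNonBacktracking_cons_cons]

theorem IsNonBacktracking.of_cons {h : G.Adj u v} {p : G.Walk v w}
    (hp : IsNonBacktracking (Walk.cons h p)) : IsNonBacktracking p :=
  List.IsChain.tail hp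

theorem isNonBacktracking_concat (p : G.Walk u v) (h : G.Adj v w) (hp : ¬ p.Nil) :
    IsNonBacktracking (p.concat h) ↔ IsNonBacktracking p ∧ p.penultimate ≠ w := by
  induction p with
  | nil => simp at hp
  | cons h' p ih =>
    cases p with
    | nil => simp [isNonBacktracking_cons_cons, isNonBacktracking_cons_nil, Walk.concat_eq_append, eq_comm]
    | cons h'' p =>
      have := ih h (by simp)
      rw [Walk.concat_cons, Walk.concat_cons, isNonBacktracking_cons_cons, ← Walk.concat_cons, this,
        isNonBacktracking_cons_cons, Walk.penultimate_cons_cons, and_assoc]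

theorem _root_.SimpleGraph.Walk.IsCycle.isNonBacktracking {p : G.Walk u u} (hp : p.IsCycle) :
    IsNonBacktracking p :=
  hp.edges_nodup.isChain

/-- A closed non-backtracking walk that is not trivial contains a cycle. -/
theorem IsNonBacktracking.containsCycle {p : G.Walk u u} (hp : IsNonBacktracking p)
    (hn : p ≠ Walk.nil) : ContainsCycle p := by
  by_contra hcon
  have hsub : ∀ e ∈ p.edges, e ∈ (fromEdgeSet p.edgeSet).edgeSet := by
    intro e he
    rw [edgeSet_fromEdgeSet]
    exact ⟨he, G.not_isDiag_of_mem_edgeSet (p.edges_subset_edgeSet he)⟩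
  have hle : fromEdgeSet p.edgeSet ≤ G := by
    intro a b hab
    rw [fromEdgeSet_adj] at hab
    exact p.adj_of_mem_edges hab.1
  -- If the walk contained no cycle, its edges would form a forest, where non-backtracking walks are
  -- paths; a closed path is trivial.
  have hac : (fromEdgeSet p.edgeSet).IsAcyclic := by
    intro v q hq
    refine hcon ⟨v, q.mapLe hle, hq.mapLe hle, ?_⟩
    intro e he
    rw [Walk.edges_mapLe_eq_edges] at he
    have := q.edges_subset_edgeSet he
    rw [edgeSet_fromEdgeSet] at this
    exact this.1
  have hpath := (hac.isPath_iff_isChain (p.transfer _ hsub)).2 (by simpa using! hp)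
  have := Walk.length_eq_zero_iff.2 (Walk.isPath_iff_nil.1 hpath)
  rw [Walk.length_transfer] at this
  exact hn (Walk.length_eq_zero_iff.1 this).eq_nil

theorem ContainsCycle.le_length {g : ℕ} (hg : G.egirth = g) {p : G.Walk u v}
    (hp : ContainsCycle p) : g ≤ p.length := by
  obtain ⟨w, q, hq, hs⟩ := hp
  have h1 : G.egirth ≤ q.length := egirth_le_length hq
  rw [hg, Nat.cast_le] at h1
  refine h1.trans ?_
  rw [← Walk.length_edges, ← Walk.length_edges]
  exact (hq.edges_nodup.subperm hs).length_le

theorem exists_closed_subwalk_of_not_isPath {p : G.Walk u v} (hp : ¬ p.IsPath) :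
    ∃ (x : V) (a : G.Walk u x) (b : G.Walk x x) (c : G.Walk x v),
      p = a.append (b.append c) ∧ b ≠ Walk.nil := by
  classical
  induction p with
  | nil => simp at hp
  | @cons u v w h p ih =>
    by_cases hpath : p.IsPath
    · have hu : u ∈ p.support := by
        by_contra hu
        exact hp ((Walk.cons_isPath_iff _ _).2 ⟨hpath, hu⟩)
      exact ⟨u, Walk.nil, Walk.cons h (p.takeUntil u hu), p.dropUntil u hu, by simp, by simp⟩
    · obtain ⟨x, a, b, c, rfl, hb⟩ := ih hpath
      exact ⟨x, Walk.cons h a, b, c, by simp, hb⟩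

/-- A closed non-backtracking walk without tail that is shorter than twice the girth is a cycle. -/
theorem IsNonBacktracking.isCycle {g : ℕ} (hg : G.egirth = g) {p : G.Walk u u}
    (hp : IsNonBacktracking p) (ht : p.snd ≠ p.penultimate) (hlen : p.length < 2 * g) :
    p.IsCycle := by
  have hn : p ≠ Walk.nil := by rintro rfl; simp at ht
  have hg3 : 3 ≤ g := by exact_mod_cast hg ▸ G.three_le_egirth
  rw [Walk.isCycle_iff_isPath_tail_and_le_length]
  refine ⟨?_, hg3.trans (ContainsCycle.le_length hg (hp.containsCycle hn))⟩
  by_contra hpath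
  -- A repeated vertex `x` cuts the closed walk into the loop `b` and the complementary loop `c`,
  -- first edge, `a`, both based at `x`.
  obtain ⟨x, a, b, c, he, hb⟩ := exists_closed_subwalk_of_not_isPath hpath
  have hadj : G.Adj u p.snd := Walk.adj_snd (by rwa [← Walk.eq_nil_iff_nil])
  have hpe : p = Walk.cons hadj (a.append (b.append c)) := by
    rw [← he, Walk.cons_tail_eq p (by rwa [← Walk.eq_nil_iff_nil])]
  have hedges : p.edges = (s(u, p.snd) :: a.edges) ++ (b.edges ++ c.edges) := by
    conv_lhs => rw [hpe]
    simp
  have hchain : ((s(u, p.snd) :: a.edges) ++ (b.edges ++ c.edges)).IsChain (· ≠ ·) := hedges ▸ hp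
  rw [List.isChain_append, List.isChain_append] at hchain
  have hlb := ContainsCycle.le_length hg (IsNonBacktracking.containsCycle hchain.2.1.1 hb)
  have hnb : IsNonBacktracking (c.append (Walk.cons hadj a)) := by
    rw [IsNonBacktracking, Walk.edges_append, List.isChain_append]
    refine ⟨hchain.2.1.2.1, by simpa using! hchain.1, ?_⟩
    intro e he f hf
    -- The only new junction is at `u`, between the last and first edges of `p`; they differ because
    -- `p` has no tail.
    have hlast : e ∈ p.edges.getLast? := by
      rw [hedges, ← List.append_assoc]
      exact List.mem_getLast?_append_of_mem_getLast? he
    have hf' : f = s(u, p.snd) := by simpa using hf.symm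
    have hlast' : e = s(p.penultimate, u) := by
      have h0 : p.edges ≠ [] := by simp [hedges]
      rw [List.getLast?_eq_some_getLast h0, Walk.getLast_edges_eq_mk_penultimate_end] at hlast
      simpa using hlast.symm
    rw [hf', hlast', ne_eq, Sym2.eq_iff]
    have := hadj.ne
    grind
  have hlc := ContainsCycle.le_length hg (hnb.containsCycle (by
    intro h
    have := congrArg Walk.length h
    simp at this))
  have := congrArg List.length hedges
  simp at this hlc
  omega

section Reduce

variable [DecidableEq V]

/-- Prepend an edge to a walk, cancelling it against the first edge if that is the same edge. -/
def consReduce (h : G.Adj u v) : G.Walk v w → G.Walk u w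
  | .nil => .cons h .nil
  | .cons (v := x) h' p => if e : x = u then p.copy e rfl else .cons h (.cons h' p)

/-- The non-backtracking walk obtained from a walk by cancelling backtracks. -/
def reduce {u v : V} : G.Walk u v → G.Walk u v
  | .nil => .nil
  | .cons h p => consReduce h (reduce p)

theorem consReduce_isNonBacktracking (h : G.Adj u v) {p : G.Walk v w}
    (hp : IsNonBacktracking p) : IsNonBacktracking (consReduce h p) := by
  cases p with
  | nil => exact isNonBacktracking_cons_nil h
  | @cons _ x _ h' p =>
    rw [consReduce]
    split_ifs with e
    · subst e
      exact hp.of_cons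
    · exact (isNonBacktracking_cons_cons _ _ _).2 ⟨e, hp⟩

theorem reduce_isNonBacktracking (p : G.Walk u v) : IsNonBacktracking (reduce p) := by
  induction p with
  | nil => exact isNonBacktracking_nil
  | cons h p ih => exact consReduce_isNonBacktracking h ih

/-- Prepending an edge either cancels or lengthens, so a non-backtracking `q` has at most two
preimages: one longer than `q` and one shorter. This drives the recursion for `liftCount`. -/
theorem consReduce_eq_iff (h : G.Adj u v) {p : G.Walk v w} {q : G.Walk u w}
    (hq : IsNonBacktracking q) :
    consReduce h p = q ↔ p = Walk.cons h.symm q ∨ (q = Walk.cons h p ∧ IsNonBacktracking q) := by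
  cases p with
  | nil => simp [consReduce, hq, eq_comm]
  | @cons _ x _ h' p =>
    rw [consReduce]
    split_ifs with e
    · subst e
      constructor
      · rintro rfl
        exact Or.inl rfl
      · rintro (h1 | ⟨rfl, -⟩)
        · simpa using h1
        · exact absurd rfl ((isNonBacktracking_cons_cons _ _ _).1 hq).1
    · constructor
      · rintro rfl
        exact Or.inr ⟨rfl, hq⟩
      · rintro (h1 | ⟨rfl, -⟩)
        · simp only [Walk.cons.injEq] at h1
          exact absurd h1.1 e
        · rfl

theorem length_reduce_le (p : G.Walk u v) : (reduce p).length ≤ p.length := by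
  induction p with
  | nil => simp [reduce]
  | cons h p ih =>
    rw [reduce, Walk.length_cons]
    cases hr : reduce p with
    | nil => simp [consReduce]
    | @cons _ x _ h' q =>
      rw [hr, Walk.length_cons] at ih
      rw [consReduce]
      split_ifs with e
      · simp; omega
      · simp; omega

/-- Each cancellation removes two traversals of the same edge, so multiplicities keep their parity
and never grow. -/
theorem count_edges_reduce (p : G.Walk u v) (e : Sym2 V) :
    ∃ k, p.edges.count e = (reduce p).edges.count e + 2 * k := by
  induction p with
  | nil => exact ⟨0, by simp [reduce]⟩
  | @cons a b _ h p ih =>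
    obtain ⟨k, hk⟩ := ih
    rw [reduce]
    cases hr : reduce p with
    | nil => rw [hr] at hk; exact ⟨k, by simp [consReduce, List.count_cons, hk]; omega⟩
    | @cons _ x _ h' q =>
      rw [hr] at hk
      rw [consReduce]
      split_ifs with e'
      · subst e'
        refine ⟨k + if s(b, x) = e then 1 else 0, ?_⟩
        simp only [Walk.edges_cons, List.count_cons, hk, Walk.copy_rfl_rfl, beq_iff_eq,
          Sym2.eq_swap (a := x)]
        split_ifs <;> omega
      · exact ⟨k, by simp only [Walk.edges_cons, List.count_cons, hk]; omega⟩

theorem containsCycle_iff_reduce_ne_nil {g : ℕ} (hg : G.egirth = g) {p : G.Walk u u}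
    (hlen : p.length < 2 * g) : ContainsCycle p ↔ reduce p ≠ Walk.nil := by
  constructor
  · rintro ⟨w, q, hq, hs⟩ hr
    have h1 : G.egirth ≤ q.length := egirth_le_length hq
    rw [hg, Nat.cast_le] at h1
    -- All multiplicities in `p` are even, so each edge of the cycle `q` occurs at least twice.
    have h2 : (q.edges ++ q.edges).Subperm p.edges := by
      rw [List.subperm_iff_count]
      intro e
      obtain ⟨k, hk⟩ := count_edges_reduce p e
      rw [hr, Walk.edges_nil, List.count_nil, zero_add] at hk
      rw [List.count_append]
      by_cases he : e ∈ q.edges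
      · have := List.count_eq_one_of_mem hq.edges_nodup he
        have := List.count_pos_iff.2 (hs he)
        omega
      · rw [List.count_eq_zero_of_not_mem he]
        omega
    have := h2.length_le
    simp at this
    omega
  · intro hr
    obtain ⟨w, q, hq, hs⟩ := (reduce_isNonBacktracking p).containsCycle hr
    refine ⟨w, q, hq, fun e he => ?_⟩
    obtain ⟨k, hk⟩ := count_edges_reduce p e
    have := List.count_pos_iff.2 (hs he)
    exact List.count_pos_iff.1 (by omega)

end Reduce

end NonBacktracking

/-! ### Counting walks with a given reduction -/

section Lifts

variable {V : Type*} {G : SimpleGraph V} {u v w x y : V}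

theorem IsBiregularBipartite.symm [Fintype V] [DecidableRel G.Adj] {U W : Set V} {c d : ℕ}
    (hG : IsBiregularBipartite G U W c d) : IsBiregularBipartite G W U d c :=
  ⟨hG.isCompl.symm, hG.bipartite.symm, hG.degree_right, hG.degree_left⟩

theorem IsBiregularBipartite.mem_of_adj [Fintype V] [DecidableRel G.Adj] {U W : Set V} {c d : ℕ}
    (hG : IsBiregularBipartite G U W c d) (hu : u ∈ U) (h : G.Adj u v) : v ∈ W :=
  hG.bipartite.mem_of_mem_adj hu h

/-- The number of walks of length `n` that reduce to a given non-backtracking walk of length `k`,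
in a graph in which the vertices along a walk have degree `a` and `b` alternately. -/
noncomputable def liftCount : ℝ → ℝ → ℕ → ℕ → ℝ
  | _, _, 0, 0 => 1
  | _, _, 0, _ + 1 => 0
  | a, b, n + 1, 0 => a * liftCount b a n 1
  -- The first step either follows the target, leaving its tail of length `k`, or goes to one of the
  -- `a - 1` other neighbors and must be undone, leaving a target of length `k + 2`. The degrees
  -- swap as the walk changes sides.
  | a, b, n + 1, k + 1 => liftCount b a n k + (a - 1) * liftCount b a n (k + 2)

theorem liftCount_of_lt (a b : ℝ) {n k : ℕ} (h : n < k) : liftCount a b n k = 0 := by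
  induction n generalizing a b k with
  | zero =>
    obtain ⟨k, rfl⟩ := Nat.exists_eq_succ_of_ne_zero h.ne'
    simp [liftCount]
  | succ n ih =>
    obtain ⟨k, rfl⟩ := Nat.exists_eq_succ_of_ne_zero (Nat.ne_zero_of_lt h)
    rw [liftCount, ih _ _ (by omega), ih _ _ (by omega)]
    simp

theorem liftCount_self (a b : ℝ) (k : ℕ) : liftCount a b k k = 1 := by
  induction k generalizing a b with
  | zero => simp [liftCount]
  | succ k ih => rw [liftCount, ih, liftCount_of_lt _ _ (by omega)]; simp

/-- Even and odd lengths feed each other in the recursion, with `a` and `b` exchanged, so both are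
proved in one induction. -/
theorem liftCount_add_two (a b : ℝ) (m : ℕ) :
    liftCount a b (2 * m + 2) (2 * m) = m * (a + b - 2) + a ∧
      liftCount b a (2 * m + 3) (2 * m + 1) = m * (a + b - 2) + a + b - 1 := by
  have step (m : ℕ) (h : liftCount a b (2 * m + 2) (2 * m) = m * (a + b - 2) + a) :
      liftCount b a (2 * m + 3) (2 * m + 1) = m * (a + b - 2) + a + b - 1 := by
    rw [liftCount, h, liftCount_self]
    ring
  induction m with
  | zero =>
    have h0 : liftCount a b (2 * 0 + 2) (2 * 0) = (0 : ℕ) * (a + b - 2) + a := by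
      simp [liftCount]
    exact ⟨h0, step 0 h0⟩
  | succ m ih =>
    have h0 : liftCount a b (2 * (m + 1) + 2) (2 * (m + 1)) = (m + 1 : ℕ) * (a + b - 2) + a := by
      rw [show 2 * (m + 1) + 2 = (2 * m + 3) + 1 by ring, show 2 * (m + 1) = (2 * m + 1) + 1 by ring,
        liftCount, ih.2, liftCount_self]
      push_cast
      ring
    exact ⟨h0, step _ h0⟩

theorem liftCount_add_four (a b : ℝ) (m : ℕ) :
    liftCount a b (2 * m + 4) (2 * m) =
      m * (a + b - 2) ^ 2 + m * (m - 1) / 2 * ((a - 1) ^ 2 + (b - 1) ^ 2)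
        + m ^ 2 * (a - 1) * (b - 1) + a * m * (a + b - 2) + a * (a + b - 1) := by
  induction m with
  | zero =>
    simp only [liftCount, mul_zero, zero_add]
    push_cast
    ring
  | succ m ih =>
    rw [show 2 * (m + 1) + 4 = (2 * m + 4) + 1 + 1 by ring,
      show 2 * (m + 1) = (2 * m + 1) + 1 by ring, liftCount, liftCount, ih,
      show 2 * m + 4 = 2 * (m + 1) + 2 by ring, show 2 * m + 2 = 2 * (m + 1) by ring,
      show 2 * m + 1 + 2 = 2 * (m + 1) + 1 by ring,
      show 2 * m + 5 = 2 * (m + 1) + 3 by ring,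
      (liftCount_add_two a b (m + 1)).1, (liftCount_add_two a b (m + 1)).2]
    push_cast
    ring

theorem adj_coe_neighborSet (w : G.neighborSet u) : G.Adj u w := w.2

variable [Fintype V] [DecidableEq V] [DecidableRel G.Adj]

theorem card_reduce_eq_succ (n : ℕ) {q : G.Walk u v} (hq : IsNonBacktracking q) :
    #{p ∈ G.finsetWalkLength (n + 1) u v | reduce p = q} =
      ∑ w : G.neighborSet u,
        (#{p ∈ G.finsetWalkLength n w v | reduce p = Walk.cons (adj_coe_neighborSet w).symm q} +
          #{p ∈ G.finsetWalkLength n w v | q = Walk.cons (adj_coe_neighborSet w) (reduce p)}) := by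
  have hd (w : G.neighborSet u) :
      #{p ∈ G.finsetWalkLength n w v | reduce p = Walk.cons (adj_coe_neighborSet w).symm q} +
          #{p ∈ G.finsetWalkLength n w v | q = Walk.cons (adj_coe_neighborSet w) (reduce p)} =
        #{p ∈ G.finsetWalkLength n w v | consReduce (adj_coe_neighborSet w) (reduce p) = q} := by
    rw [← card_union_of_disjoint, ← filter_or]
    · congr 1
      ext p
      simp only [mem_filter, and_congr_right_iff]
      intro _
      rw [consReduce_eq_iff _ hq]
      simp [hq]
    -- The reduction would be one step longer than `q` and one step shorter.
    · rw [disjoint_filter]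
      intro p _ h1 h2
      have e1 := congrArg Walk.length h1
      have e2 := congrArg Walk.length h2
      rw [Walk.length_cons] at e1 e2
      omega
  simp_rw [hd]
  rw [finsetWalkLength, filter_biUnion, card_biUnion]
  · refine sum_congr rfl fun w _ => ?_
    rw [filter_map, card_map]
    rfl
  · rintro ⟨w, hw⟩ - ⟨w', hw'⟩ - hne
    rw [Function.onFun, Finset.disjoint_left]
    simp only [mem_filter, mem_map, not_and]
    rintro p ⟨⟨p1, -, rfl⟩, -⟩ ⟨p2, -, h⟩
    cases h
    exact absurd rfl hne

theorem card_reduce_eq_zero (n : ℕ) {q : G.Walk u v} (hq : ¬ IsNonBacktracking q) :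
    #{p ∈ G.finsetWalkLength n u v | reduce p = q} = 0 := by
  rw [card_eq_zero, filter_eq_empty_iff]
  rintro p - rfl
  exact hq (reduce_isNonBacktracking p)

theorem card_reduce_eq {U W : Set V} {c d : ℕ} (hG : IsBiregularBipartite G U W c d) (n : ℕ)
    (hu : u ∈ U) {q : G.Walk u v} (hq : IsNonBacktracking q) :
    (#{p ∈ G.finsetWalkLength n u v | reduce p = q} : ℝ) = liftCount c d n q.length := by
  induction n generalizing U W c d u with
  | zero =>
    cases q with
    | nil => simp [finsetWalkLength, reduce, liftCount, filter_singleton]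
    | cons h q =>
      rw [Walk.length_cons, liftCount, Nat.cast_eq_zero, card_eq_zero, filter_eq_empty_iff]
      intro p hp hr
      rw [mem_finsetWalkLength_iff] at hp
      have := length_reduce_le p
      rw [hr, Walk.length_cons] at this
      omega
  | succ n ih =>
    have hdeg : Fintype.card (G.neighborSet u) = c := by
      rw [G.card_neighborSet_eq_degree, hG.degree_left u hu]
    rw [card_reduce_eq_succ n hq, Nat.cast_sum]
    cases q with
    | nil =>
      have hw (w : G.neighborSet v) :
          ((#{p ∈ G.finsetWalkLength n w v | reduce p = Walk.cons (adj_coe_neighborSet w).symm Walk.nil} +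
            #{p ∈ G.finsetWalkLength n w v | Walk.nil = Walk.cons (adj_coe_neighborSet w) (reduce p)} : ℕ) : ℝ) =
          liftCount d c n 1 := by
        rw [Nat.cast_add, ih hG.symm (hG.mem_of_adj hu (adj_coe_neighborSet w)) (isNonBacktracking_cons_nil _)]
        simp
      rw [sum_congr rfl fun w _ => hw w, sum_const, card_univ, hdeg, nsmul_eq_mul,
        Walk.length_nil, liftCount]
    | @cons _ x _ h q =>
      have hx : ((#{p ∈ G.finsetWalkLength n x v | reduce p = Walk.cons h.symm (Walk.cons h q)} +
            #{p ∈ G.finsetWalkLength n x v | Walk.cons h q = Walk.cons h (reduce p)} : ℕ) : ℝ) =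
          liftCount d c n q.length := by
        -- Along the first edge of the target itself, the lengthened target backtracks, so only the
        -- shortened one contributes.
        rw [card_reduce_eq_zero n (by simp [isNonBacktracking_cons_cons]), zero_add,
          ← ih hG.symm (hG.mem_of_adj hu h) hq.of_cons]
        simp [eq_comm]
      have hw (w : G.neighborSet u) (hne : w ≠ ⟨x, h⟩) :
          ((#{p ∈ G.finsetWalkLength n w v | reduce p = Walk.cons (adj_coe_neighborSet w).symm (Walk.cons h q)} +
            #{p ∈ G.finsetWalkLength n w v | Walk.cons h q = Walk.cons (adj_coe_neighborSet w) (reduce p)} : ℕ) : ℝ) =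
          liftCount d c n (q.length + 2) := by
        have hne' : x ≠ w := fun e => hne (Subtype.ext e.symm)
        rw [Nat.cast_add, ih hG.symm (hG.mem_of_adj hu (adj_coe_neighborSet w))
          ((isNonBacktracking_cons_cons _ _ _).2 ⟨hne', hq⟩), Walk.length_cons, Walk.length_cons]
        rw [filter_false_of_mem]
        · simp
        · intro p _ he
          simp only [Walk.cons.injEq] at he
          exact hne' he.1
      rw [← add_sum_erase _ _ (mem_univ (⟨x, h⟩ : G.neighborSet u)), hx,
        sum_congr rfl fun w hw' => hw w (ne_of_mem_erase hw'), sum_const,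
        card_erase_of_mem (mem_univ _), card_univ, hdeg, Walk.length_cons, liftCount, nsmul_eq_mul,
        Nat.cast_sub, Nat.cast_one]
      rw [← hdeg]
      exact Fintype.card_pos_iff.2 ⟨⟨x, h⟩⟩

variable (G) in
/-- The closed walks of length `n`, with their initial vertices. -/
def closedWalks (n : ℕ) : Finset (Σ v : V, G.Walk v v) :=
  univ.sigma fun v => G.finsetWalkLength n v v

theorem mem_closedWalks {n : ℕ} {p : Σ v : V, G.Walk v v} :
    p ∈ closedWalks G n ↔ p.2.length = n := by
  simp [closedWalks, mem_finsetWalkLength_iff]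

open scoped Classical in
-- Closed walks are grouped by their reduction, and each fibre has size `liftCount`.
theorem card_reduce_ne_nil {U W : Set V} {c d : ℕ} (hG : IsBiregularBipartite G U W c d) (n : ℕ) :
    (#{p ∈ closedWalks G n | p.1 ∈ U ∧ reduce p.2 ≠ Walk.nil} : ℝ) =
      ∑ k ∈ range (n + 1), liftCount c d n k *
        #{p ∈ closedWalks G k | p.1 ∈ U ∧ IsNonBacktracking p.2 ∧ p.2 ≠ Walk.nil} := by
  have hmaps : ∀ p ∈ (closedWalks G n).filter fun p => p.1 ∈ U ∧ reduce p.2 ≠ Walk.nil,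
      (⟨p.1, reduce p.2⟩ : Σ v : V, G.Walk v v) ∈ (range (n + 1)).biUnion fun k =>
        (closedWalks G k).filter fun p => p.1 ∈ U ∧ IsNonBacktracking p.2 ∧ p.2 ≠ Walk.nil := by
    intro p hp
    simp only [mem_filter, mem_closedWalks] at hp
    simp only [mem_biUnion, mem_filter, mem_closedWalks, mem_range]
    refine ⟨_, ?_, rfl, hp.2.1, reduce_isNonBacktracking _, hp.2.2⟩
    have := length_reduce_le p.2
    omega
  rw [card_eq_sum_card_fiberwise hmaps, sum_biUnion, Nat.cast_sum]
  · refine sum_congr rfl fun k _ => ?_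
    rw [mul_comm, ← nsmul_eq_mul, Nat.cast_sum, ← sum_const]
    refine sum_congr rfl fun q hq => ?_
    obtain ⟨v, q⟩ := q
    simp only [mem_filter, mem_closedWalks] at hq
    obtain ⟨rfl, hv, hnb, hnil⟩ := hq
    rw [← card_reduce_eq hG n hv hnb, Nat.cast_inj]
    symm
    refine card_bij (fun p _ => ⟨v, p⟩) ?_ (by simp) ?_
    · intro p hp
      simp only [mem_filter, mem_finsetWalkLength_iff] at hp
      simp only [mem_filter, mem_closedWalks, hp, hv, ne_eq, hnil, not_false_eq_true, and_self]
    · rintro ⟨w, p⟩ hp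
      simp only [mem_filter, mem_closedWalks, Sigma.mk.injEq] at hp
      obtain ⟨⟨hl, -⟩, rfl, hr⟩ := hp
      exact ⟨p, by simpa [mem_finsetWalkLength_iff, hl] using hr, rfl⟩
  · intro k _ l _ hkl
    rw [Function.onFun, Finset.disjoint_left]
    intro p hp hp'
    simp only [mem_filter, mem_closedWalks] at hp hp'
    exact hkl (hp.1.symm.trans hp'.1)

end Lifts

/-! ### Cycles as subgraphs and as based closed walks -/

section CycleCounts

variable {V : Type*} {G : SimpleGraph V} {u v w x y : V}

theorem cycle_length_eq_of_toSubgraph_eq {p : G.Walk u u} {q : G.Walk v v} (hp : p.IsCycle)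
    (hq : q.IsCycle) (hs : q.toSubgraph = p.toSubgraph) : q.length = p.length := by
  have he : q.edgeSet = p.edgeSet := by
    rw [← Walk.edgeSet_toSubgraph, ← Walk.edgeSet_toSubgraph, hs]
  rw [← Walk.length_edges, ← Walk.length_edges]
  exact ((List.perm_ext_iff_of_nodup hq.edges_nodup hp.edges_nodup).2
    fun e => Set.ext_iff.1 he e).length_eq

/-- Every vertex of a cycle has just two neighbors in its subgraph, so the next vertex is the one
that was not just left; the first step fixes all the others. -/
theorem cycle_eq_of_toSubgraph_eq {p q : G.Walk u u} (hp : p.IsCycle) (hq : q.IsCycle)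
    (hs : q.toSubgraph = p.toSubgraph) (h : q.snd = p.snd) : q = p := by
  have hlen := cycle_length_eq_of_toSubgraph_eq hp hq hs
  have key : ∀ i, i + 1 ≤ p.length →
      q.getVert i = p.getVert i ∧ q.getVert (i + 1) = p.getVert (i + 1) := by
    intro i
    induction i with
    | zero => exact fun _ => ⟨by simp, h⟩
    | succ i ih =>
      intro hi
      obtain ⟨h1, h2⟩ := ih (by omega)
      refine ⟨h2, ?_⟩
      have e1 := hp.neighborSet_toSubgraph_internal (i := i + 1) (by omega) (by omega)
      have e2 := hq.neighborSet_toSubgraph_internal (i := i + 1) (by omega) (by omega)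
      rw [hs, h2, e1, Nat.add_sub_cancel, h1] at e2
      have hne := hq.getVert_sub_one_ne_getVert_add_one (i := i + 1) (by omega)
      have hmem : q.getVert (i + 1 + 1) ∈ ({p.getVert i, p.getVert (i + 1 + 1)} : Set V) := by
        rw [e2]
        simp
      rw [Nat.add_sub_cancel, h1] at hne
      simpa [hne.symm] using hmem
  refine Walk.ext_getVert_le_length hlen fun i hi => ?_
  cases i with
  | zero => simp
  | succ i => exact (key i (hlen ▸ hi)).2

variable [Fintype V] [DecidableRel G.Adj]

open scoped Classical in
-- Sides alternate along a walk. Dropping the initial vertex counts the base of a closed walk once,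
-- and the two indicators then cancel.
theorem two_mul_countP_support_tail {U W : Set V} {c d : ℕ} (hG : IsBiregularBipartite G U W c d)
    (p : G.Walk u v) :
    2 * p.support.tail.countP (· ∈ U) + (if u ∈ U then 1 else 0) =
      p.length + if v ∈ U then 1 else 0 := by
  induction p with
  | nil => simp
  | @cons u v w h p ih =>
    have huv : u ∈ U ↔ v ∉ U := by
      constructor
      · exact fun hu hv => Set.disjoint_left.1 hG.isCompl.disjoint hv (hG.mem_of_adj hu h)
      · intro hv
        have hv' : v ∈ W := (hG.isCompl.sup_eq_top.ge (Set.mem_univ v)).resolve_left hv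
        exact hG.symm.mem_of_adj hv' h.symm
    rw [Walk.support_cons, List.tail_cons, ← Walk.cons_tail_support, List.countP_cons, Walk.length_cons]
    by_cases hv : v ∈ U
    · have hu : u ∉ U := by simpa [huv] using hv
      simp only [hv, hu, if_true, if_false, decide_true] at ih ⊢
      omega
    · have hu : u ∈ U := huv.2 hv
      simp only [hv, hu, if_true, if_false, decide_false, Bool.false_eq_true] at ih ⊢
      omega

theorem even_length_closed {U W : Set V} {c d : ℕ} (hG : IsBiregularBipartite G U W c d)
    (p : G.Walk u u) : Even p.length := by
  classical
  have := two_mul_countP_support_tail hG p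
  exact ⟨p.support.tail.countP (· ∈ U), by omega⟩

variable [DecidableEq V]

open scoped Classical in
theorem card_cycles_toSubgraph_eq {p : G.Walk u u} (hp : p.IsCycle) :
    #{q ∈ G.finsetWalkLength p.length u u | q.IsCycle ∧ q.toSubgraph = p.toSubgraph} = 2 := by
  rw [card_eq_two]
  refine ⟨p, p.reverse, ?_, ?_⟩
  · intro h
    apply hp.snd_ne_penultimate
    conv_lhs => rw [h]
    simp
  · ext q
    simp only [mem_filter, mem_finsetWalkLength_iff, mem_insert, mem_singleton]
    constructor
    · rintro ⟨-, hq, hs⟩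
      have hmem : q.snd ∈ p.toSubgraph.neighborSet u := by
        rw [← hs]
        exact q.toSubgraph_adj_snd hq.not_nil
      rw [hp.neighborSet_toSubgraph_endpoint] at hmem
      rcases hmem with h | h
      · exact Or.inl (cycle_eq_of_toSubgraph_eq hp hq hs h)
      · refine Or.inr (cycle_eq_of_toSubgraph_eq hp.reverse hq (by simpa using hs) ?_)
        rw [h]
        simp
    · rintro (rfl | rfl)
      · exact ⟨rfl, hp, rfl⟩
      · exact ⟨by simp, hp.reverse, by simp⟩

open scoped Classical in
theorem two_mul_card_cycle_support {U W : Set V} {c d : ℕ} (hG : IsBiregularBipartite G U W c d)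
    {p : G.Walk u u} (hp : p.IsCycle) : 2 * #{v | v ∈ U ∧ v ∈ p.support} = p.length := by
  have h : ({v | v ∈ U ∧ v ∈ p.support} : Finset V) =
      (p.support.tail.filter (· ∈ U)).toFinset := by
    ext v
    simp only [mem_filter, mem_univ, true_and, List.mem_toFinset, List.mem_filter,
      decide_eq_true_eq]
    rw [and_comm, ← Walk.cons_tail_support, List.mem_cons, List.tail_cons]
    refine and_congr_left fun _ => or_iff_right_of_imp ?_
    rintro rfl
    exact p.end_mem_tail_support hp.not_nil
  rw [h, List.toFinset_card_of_nodup (hp.support_nodup.filter _), ← List.countP_eq_length_filter]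
  have := two_mul_countP_support_tail hG p
  omega

open scoped Classical in
theorem card_cycles_from_toSubgraph_eq {U W : Set V} {c d : ℕ}
    (hG : IsBiregularBipartite G U W c d) {p : G.Walk u u} (hp : p.IsCycle) :
    #{q ∈ closedWalks G p.length | (q.1 ∈ U ∧ q.2.IsCycle) ∧ q.2.toSubgraph = p.toSubgraph} =
      p.length := by
  have h : ({q ∈ closedWalks G p.length |
        (q.1 ∈ U ∧ q.2.IsCycle) ∧ q.2.toSubgraph = p.toSubgraph} : Finset _) =
      ({v | v ∈ U ∧ v ∈ p.support} : Finset V).sigma fun v =>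
        {q ∈ G.finsetWalkLength p.length v v | q.IsCycle ∧ q.toSubgraph = p.toSubgraph} := by
    ext ⟨v, q⟩
    simp only [mem_filter, mem_closedWalks, mem_sigma, mem_univ, true_and,
      mem_finsetWalkLength_iff]
    constructor
    · rintro ⟨hl, ⟨hv, hq⟩, hs⟩
      refine ⟨⟨hv, ?_⟩, hl, hq, hs⟩
      rw [← Walk.mem_verts_toSubgraph, ← hs]
      exact q.start_mem_verts_toSubgraph
    · rintro ⟨⟨hv, -⟩, hl, hq, hs⟩
      exact ⟨hl, ⟨hv, hq⟩, hs⟩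
  rw [h, card_sigma, sum_congr rfl (g := fun _ => 2), sum_const, smul_eq_mul, mul_comm]
  · exact two_mul_card_cycle_support hG hp
  · intro v hv
    simp only [mem_filter, mem_univ, true_and] at hv
    have := card_cycles_toSubgraph_eq (hp.rotate hv.2)
    rwa [cycle_length_eq_of_toSubgraph_eq hp (hp.rotate hv.2) (p.toSubgraph_rotate hv.2),
      p.toSubgraph_rotate hv.2] at this

open scoped Classical in
-- A cycle of length `k` has `k / 2` vertices in `U`, and each of them starts it in two directions.
theorem card_cycles {U W : Set V} {c d : ℕ} (hG : IsBiregularBipartite G U W c d) (k : ℕ) :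
    #{p ∈ closedWalks G k | p.1 ∈ U ∧ p.2.IsCycle} = k * numCycles G k := by
  have hN : numCycles G k =
      #(((closedWalks G k).filter fun p => p.2.IsCycle).image fun p => p.2.toSubgraph) := by
    rw [numCycles, ← Set.ncard_coe_finset]
    congr 1
    ext H
    simp only [Set.mem_ofPred_eq, coe_image, Set.mem_image, mem_coe, mem_filter, mem_closedWalks,
      Sigma.exists]
    grind
  rw [hN, card_eq_sum_card_fiberwise (f := fun p => p.2.toSubgraph)
    (t := ((closedWalks G k).filter fun p => p.2.IsCycle).image fun p => p.2.toSubgraph),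
    sum_congr rfl (g := fun _ => k), sum_const, smul_eq_mul, mul_comm]
  · intro H hH
    simp only [mem_image, mem_filter, mem_closedWalks] at hH
    obtain ⟨⟨v, p⟩, ⟨rfl, hp⟩, rfl⟩ := hH
    rw [filter_filter]
    exact card_cycles_from_toSubgraph_eq hG hp
  · intro p hp
    simp only [coe_filter, Set.mem_ofPred_eq] at hp
    exact mem_coe.2 (mem_image_of_mem _ (mem_filter.2 ⟨hp.1, hp.2.2⟩))

end CycleCounts

/-! ### Peeling tails off non-backtracking closed walks -/

section Tails

variable {V : Type*} {G : SimpleGraph V} {u v w x y : V}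

theorem penultimate_cons_concat (h : G.Adj u v) (q : G.Walk v w) (h' : G.Adj w x) :
    (Walk.cons h (q.concat h')).penultimate = w := by
  rw [← Walk.concat_cons, Walk.penultimate_concat]

theorem isNonBacktracking_cons_concat (h : G.Adj v u) (h' : G.Adj u v) {q : G.Walk u u}
    (hq : ¬ q.Nil) :
    IsNonBacktracking (Walk.cons h (q.concat h')) ↔
      IsNonBacktracking q ∧ q.snd ≠ v ∧ q.penultimate ≠ v := by
  rw [← Walk.concat_cons, isNonBacktracking_concat _ _ (by simp), isNonBacktracking_cons _ _ hq,
    Walk.penultimate_cons_of_not_nil _ _ hq]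
  tauto

variable [Fintype V] [DecidableEq V] [DecidableRel G.Adj]

open scoped Classical in
-- A tailed walk is an edge, a shorter closed walk from the other side, and the same edge back. The
-- added neighbor must avoid the second and penultimate vertices of the inner walk.
theorem card_tailed {U W : Set V} {c d : ℕ} (hG : IsBiregularBipartite G U W c d) {k : ℕ}
    (hk : k ≠ 0) :
    #{p ∈ closedWalks G (k + 2) | p.1 ∈ U ∧ IsNonBacktracking p.2 ∧ p.2.snd = p.2.penultimate} =
      ∑ q ∈ closedWalks G k with q.1 ∈ W ∧ IsNonBacktracking q.2,
        #((G.neighborFinset q.1).filter fun v => q.2.snd ≠ v ∧ q.2.penultimate ≠ v) := by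
  have hnil {q : Σ v : V, G.Walk v v} (hq : q.2.length = k) : ¬ q.2.Nil := by
    rw [← Walk.length_eq_zero_iff]
    omega
  rw [← card_sigma]
  symm
  have hadj {a : Σ _ : (Σ v : V, G.Walk v v), V}
      (ha : a ∈ (((closedWalks G k).filter fun q => q.1 ∈ W ∧ IsNonBacktracking q.2).sigma fun q =>
        (G.neighborFinset q.1).filter fun v => q.2.snd ≠ v ∧ q.2.penultimate ≠ v)) :
      G.Adj a.1.1 a.2 := by
    simp only [mem_sigma, mem_filter, mem_neighborFinset] at ha
    exact ha.2.1
  refine card_bij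
    (fun a ha => ⟨a.2, Walk.cons (hadj ha).symm (a.1.2.concat (hadj ha))⟩) ?_ ?_ ?_
  · rintro ⟨⟨u, q⟩, v⟩ ha
    have h := hadj ha
    simp only [mem_sigma, mem_filter, mem_neighborFinset, mem_closedWalks] at ha ⊢
    obtain ⟨⟨hl, hu, hq⟩, -, h1, h2⟩ := ha
    have hn : ¬ q.Nil := hnil (q := ⟨u, q⟩) hl
    refine ⟨by simp [hl], hG.symm.mem_of_adj hu h,
      (isNonBacktracking_cons_concat _ _ hn).2 ⟨hq, h1, h2⟩, ?_⟩
    rw [penultimate_cons_concat, Walk.snd_cons]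
  · rintro ⟨⟨u, q⟩, v⟩ ha ⟨⟨u', q'⟩, v'⟩ ha' he
    simp only [Sigma.mk.injEq] at he
    obtain ⟨rfl, he⟩ := he
    simp only [heq_eq_eq, Walk.cons.injEq] at he
    obtain ⟨rfl, he⟩ := he
    obtain ⟨_, hq⟩ := Walk.concat_inj (eq_of_heq he)
    rw [Walk.copy_rfl_rfl] at hq
    subst hq
    rfl
  · rintro ⟨v, p⟩ hp
    simp only [mem_filter, mem_closedWalks] at hp
    obtain ⟨hl, hv, hnb, ht⟩ := hp
    cases p with
    | nil => simp at hl
    | @cons _ u _ h p =>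
      cases p with
      | nil => simp at hl
      | cons h1 p =>
        obtain ⟨x, q, h', e⟩ := Walk.exists_cons_eq_concat h1 p
        rw [e] at hl hnb ht ⊢
        have hx : u = x := by
          rwa [penultimate_cons_concat, Walk.snd_cons] at ht
        subst hx
        have hl' : q.length = k := by simpa using hl
        have hn : ¬ q.Nil := hnil (q := ⟨u, q⟩) hl'
        obtain ⟨n1, n2, n3⟩ := (isNonBacktracking_cons_concat _ _ hn).1 hnb
        refine ⟨⟨⟨u, q⟩, v⟩, ?_, rfl⟩
        simp only [mem_sigma, mem_filter, mem_neighborFinset, mem_closedWalks]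
        exact ⟨⟨hl', hG.mem_of_adj hv h, n1⟩, h', n2, n3⟩

theorem card_neighbors_avoiding {q : G.Walk u u} (hq : ¬ q.Nil) :
    (#((G.neighborFinset u).filter fun v => q.snd ≠ v ∧ q.penultimate ≠ v) : ℝ) =
      G.degree u - 1 - if q.snd = q.penultimate then 0 else 1 := by
  have h1 : q.snd ∈ G.neighborFinset u := by simpa using q.adj_snd hq
  have h2 : q.penultimate ∈ G.neighborFinset u := by simpa using (q.adj_penultimate hq).symm
  have hs : ((G.neighborFinset u).filter fun v => q.snd ≠ v ∧ q.penultimate ≠ v) =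
      G.neighborFinset u \ {q.snd, q.penultimate} := by
    ext v
    simp only [mem_filter, mem_sdiff, mem_insert, mem_singleton, not_or, ne_eq, eq_comm]
  have hsub : ({q.snd, q.penultimate} : Finset V) ⊆ G.neighborFinset u := by
    simp only [insert_subset_iff, singleton_subset_iff]
    exact ⟨h1, h2⟩
  rw [hs, cast_card_sdiff hsub, G.card_neighborFinset_eq_degree]
  split_ifs with h
  · simp [h]
  · rw [card_pair h]
    push_cast
    ring

open scoped Classical in
/-- The closed non-backtracking walks of length `k + 2` arise from closed walks without tail of
that length and from prepending and appending an edge to a walk of length `k`. -/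
theorem card_isNonBacktracking_add_two {U W : Set V} {c d : ℕ}
    (hG : IsBiregularBipartite G U W c d) {k : ℕ} (hk : k ≠ 0) :
    (#{p ∈ closedWalks G (k + 2) | p.1 ∈ U ∧ IsNonBacktracking p.2} : ℝ) =
      #{p ∈ closedWalks G (k + 2) |
          p.1 ∈ U ∧ IsNonBacktracking p.2 ∧ p.2.snd ≠ p.2.penultimate} +
      ((d - 1) * #{p ∈ closedWalks G k | p.1 ∈ W ∧ IsNonBacktracking p.2} -
        #{p ∈ closedWalks G k |
          p.1 ∈ W ∧ IsNonBacktracking p.2 ∧ p.2.snd ≠ p.2.penultimate}) := by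
  rw [← card_filter_add_card_filter_not (fun p => p.2.snd = p.2.penultimate) (s :=
    {p ∈ closedWalks G (k + 2) | p.1 ∈ U ∧ IsNonBacktracking p.2}), filter_filter, filter_filter]
  simp only [and_assoc]
  rw [card_tailed hG hk, add_comm, Nat.cast_add, Nat.cast_sum]
  congr 1
  -- The forbidden neighbors are two when the inner walk has no tail and coincide when it has one,
  -- leaving `d - 2` or `d - 1` choices.
  have hterm : ∀ q ∈ (closedWalks G k).filter fun q => q.1 ∈ W ∧ IsNonBacktracking q.2,
      (#((G.neighborFinset q.1).filter fun v => q.2.snd ≠ v ∧ q.2.penultimate ≠ v) : ℝ) =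
        (d - 1) - if q.2.snd ≠ q.2.penultimate then 1 else 0 := by
    intro q hq
    simp only [mem_filter, mem_closedWalks] at hq
    rw [card_neighbors_avoiding (by rw [← Walk.length_eq_zero_iff]; omega),
      hG.degree_right _ hq.2.1]
    simp only [ne_eq, ite_not]
  rw [sum_congr rfl hterm, sum_sub_distrib, sum_const, nsmul_eq_mul, mul_comm, sum_boole,
    filter_filter]
  simp only [and_assoc]

end Tails

/-! ### Counts at lengths near the girth -/

section GirthCounts

variable {V : Type*} {G : SimpleGraph V} {u v w x y : V}

variable {U W : Set V} {c d g : ℕ}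

theorem not_isNonBacktracking_of_length_lt (hg : G.egirth = g) {p : G.Walk u u} (h0 : p.length ≠ 0)
    (hlt : p.length < g) : ¬ IsNonBacktracking p := by
  intro hp
  have := ContainsCycle.le_length hg (hp.containsCycle (by rintro rfl; simp at h0))
  omega

theorem numCycles_of_lt [Finite V] (hg : G.egirth = g) {k : ℕ} (hlt : k < g) : numCycles G k = 0 := by
  rw [numCycles, Set.ncard_eq_zero, Set.eq_empty_iff_forall_notMem]
  rintro H ⟨v, p, hp, rfl, -⟩
  have := egirth_le_length hp
  rw [hg, Nat.cast_le] at this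
  omega

theorem even_of_egirth_eq [Fintype V] [DecidableRel G.Adj]
    (hG : IsBiregularBipartite G U W c d) (hg : G.egirth = g) : Even g := by
  have hac : ¬ G.IsAcyclic := by
    rw [← egirth_eq_top, hg]
    exact ENat.natCast_ne_top g
  obtain ⟨v, p, -, hp⟩ := exists_egirth_eq_length.2 hac
  rw [hg, Nat.cast_inj] at hp
  exact hp ▸ even_length_closed hG p

variable [Fintype V] [DecidableEq V] [DecidableRel G.Adj]

theorem _root_.Matrix.IsHermitian.sum_eigenvalues_pow {n : Type*} [Fintype n] [DecidableEq n]
    {A : Matrix n n ℝ} (hA : A.IsHermitian) (k : ℕ) :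
    ∑ i, hA.eigenvalues i ^ k = (A ^ k).trace := by
  conv_rhs => rw [hA.spectral_theorem]
  rw [← map_pow, Unitary.conjStarAlgAut_apply, Matrix.trace_mul_cycle, Unitary.coe_star_mul_self,
    one_mul, Matrix.diagonal_pow, Matrix.trace_diagonal]
  simp

/-- Both sides are the trace of a power of the adjacency matrix. -/
theorem sum_eigenvalues_pow_eq_card_closedWalks (n : ℕ) :
    ∑ j : V, (G.isHermitian_adjMatrix ℝ).eigenvalues j ^ n = #(closedWalks G n) := by
  rw [Matrix.IsHermitian.sum_eigenvalues_pow, Matrix.trace, closedWalks, card_sigma, Nat.cast_sum]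
  refine sum_congr rfl fun v _ => ?_
  rw [Matrix.diag_apply, G.adjMatrix_pow_apply_eq_card_walk, G.card_set_walk_length_eq]

open scoped Classical in
theorem card_tailless (hG : IsBiregularBipartite G U W c d) (hg : G.egirth = g) {k : ℕ}
    (hk : k < 2 * g) :
    #{p ∈ closedWalks G k | p.1 ∈ U ∧ IsNonBacktracking p.2 ∧ p.2.snd ≠ p.2.penultimate} =
      k * numCycles G k := by
  rw [← card_cycles hG]
  congr 1
  refine filter_congr fun p hp => and_congr_right fun _ => ?_
  rw [mem_closedWalks] at hp
  exact ⟨fun h => h.1.isCycle hg h.2 (hp ▸ hk),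
    fun h => ⟨h.isNonBacktracking, h.snd_ne_penultimate⟩⟩

open scoped Classical in
theorem card_isNonBacktracking_of_lt (hg : G.egirth = g) {k : ℕ} (h0 : k ≠ 0) (hlt : k < g)
    (S : Set V) : #{p ∈ closedWalks G k | p.1 ∈ S ∧ IsNonBacktracking p.2} = 0 := by
  rw [card_eq_zero, filter_eq_empty_iff]
  intro p hp h
  rw [mem_closedWalks] at hp
  exact not_isNonBacktracking_of_length_lt hg (hp ▸ h0) (hp ▸ hlt) h.2

open scoped Classical in
theorem card_isNonBacktracking_girth (hG : IsBiregularBipartite G U W c d) (hg : G.egirth = g)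
    (h2 : 2 < g) :
    (#{p ∈ closedWalks G g | p.1 ∈ U ∧ IsNonBacktracking p.2} : ℝ) = g * numCycles G g := by
  obtain ⟨k, rfl⟩ := Nat.exists_eq_add_of_lt h2
  -- Here `k + 1` is the girth minus 2: positive and below the girth, so nothing is left to carry a
  -- tail.
  have e : 2 + k + 1 = (k + 1) + 2 := by ring
  simp only [e] at *
  rw [card_isNonBacktracking_add_two hG (by omega), card_tailless hG hg (by omega),
    card_tailless hG.symm hg (by omega), card_isNonBacktracking_of_lt hg (by omega) (by omega),
    numCycles_of_lt hg (k := k + 1) (by omega)]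
  push_cast
  ring

open scoped Classical in
theorem card_isNonBacktracking_girth_add_two (hG : IsBiregularBipartite G U W c d)
    (hg : G.egirth = g) (h2 : 2 < g) :
    (#{p ∈ closedWalks G (g + 2) | p.1 ∈ U ∧ IsNonBacktracking p.2} : ℝ) =
      (g + 2) * numCycles G (g + 2) + (d - 2) * (g * numCycles G g) := by
  rw [card_isNonBacktracking_add_two hG (by omega), card_tailless hG hg (by omega),
    card_tailless hG.symm hg (by omega), card_isNonBacktracking_girth hG.symm hg h2]
  push_cast
  ring

open scoped Classical in
theorem card_isNonBacktracking_girth_add_four (hG : IsBiregularBipartite G U W c d)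
    (hg : G.egirth = g) (h4 : 4 < g) :
    (#{p ∈ closedWalks G (g + 4) | p.1 ∈ U ∧ IsNonBacktracking p.2} : ℝ) =
      (g + 4) * numCycles G (g + 4) + (d - 2) * ((g + 2) * numCycles G (g + 2)) +
        (d - 1) * (c - 2) * (g * numCycles G g) := by
  rw [show g + 4 = (g + 2) + 2 by ring, card_isNonBacktracking_add_two hG (by omega),
    card_tailless hG hg (by omega), card_tailless hG.symm hg (by omega),
    card_isNonBacktracking_girth_add_two hG.symm hg (by omega)]
  push_cast
  ring

open scoped Classical in
-- Only reduced lengths `2 * m`, `2 * m + 2` and `2 * m + 4` contribute: shorter nontrivial ones are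
-- excluded by the girth, odd ones by bipartiteness.
theorem card_containsCycle_from (hG : IsBiregularBipartite G U W c d) {m : ℕ}
    (hg : G.egirth = (2 * m : ℕ)) (hm : 4 < 2 * m) :
    (#{p ∈ closedWalks G (2 * m + 4) | p.1 ∈ U ∧ ContainsCycle p.2} : ℝ) =
      (2 * m + 4) * numCycles G (2 * m + 4) + (d - 2) * ((2 * m + 2) * numCycles G (2 * m + 2)) +
        (d - 1) * (c - 2) * (2 * m * numCycles G (2 * m)) +
      ((m + 1) * (c + d - 2) + c) *
        ((2 * m + 2) * numCycles G (2 * m + 2) + (d - 2) * (2 * m * numCycles G (2 * m))) +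
      (m * (c + d - 2) ^ 2 + m * (m - 1) / 2 * ((c - 1) ^ 2 + (d - 1) ^ 2)
        + m ^ 2 * (c - 1) * (d - 1) + c * m * (c + d - 2) + c * (c + d - 1)) *
        (2 * m * numCycles G (2 * m)) := by
  have hred : ({p ∈ closedWalks G (2 * m + 4) | p.1 ∈ U ∧ ContainsCycle p.2} : Finset _) =
      {p ∈ closedWalks G (2 * m + 4) | p.1 ∈ U ∧ reduce p.2 ≠ Walk.nil} := by
    refine filter_congr fun p hp => and_congr_right fun _ => ?_
    rw [mem_closedWalks] at hp
    exact containsCycle_iff_reduce_ne_nil hg (by omega)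
  have hT {k : ℕ} (hk : k ≠ 0) :
      #{p ∈ closedWalks G k | p.1 ∈ U ∧ IsNonBacktracking p.2 ∧ p.2 ≠ Walk.nil} =
        #{p ∈ closedWalks G k | p.1 ∈ U ∧ IsNonBacktracking p.2} := by
    congr 1
    refine filter_congr fun p hp => and_congr_right fun _ => and_iff_left ?_
    rw [mem_closedWalks] at hp
    intro h
    rw [h] at hp
    exact hk hp.symm
  have hodd (k : ℕ) :
      #{p ∈ closedWalks G (2 * k + 1) | p.1 ∈ U ∧ IsNonBacktracking p.2 ∧ p.2 ≠ Walk.nil} = 0 := by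
    rw [card_eq_zero, filter_eq_empty_iff]
    intro p hp
    rw [mem_closedWalks] at hp
    have := even_length_closed hG p.2
    grind
  have hsmall : ∀ k ∈ range (2 * m), liftCount c d (2 * m + 4) k *
      (#{p ∈ closedWalks G k | p.1 ∈ U ∧ IsNonBacktracking p.2 ∧ p.2 ≠ Walk.nil} : ℝ) = 0 := by
    intro k hk
    rw [mem_range] at hk
    rcases eq_or_ne k 0 with rfl | h0
    · rw [mul_eq_zero, Nat.cast_eq_zero, card_eq_zero, filter_eq_empty_iff]
      right
      rintro p hp ⟨-, -, hn⟩
      rw [mem_closedWalks, Walk.length_eq_zero_iff] at hp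
      exact hn hp.eq_nil
    · rw [hT h0, card_isNonBacktracking_of_lt hg h0 hk]
      simp
  rw [hred, card_reduce_ne_nil hG]
  simp only [sum_range_succ]
  rw [sum_eq_zero hsmall, hodd, show 2 * m + 3 = 2 * (m + 1) + 1 by ring, hodd, hT (by omega),
    hT (by omega), hT (by omega), card_isNonBacktracking_girth hG hg (by omega),
    card_isNonBacktracking_girth_add_two hG hg (by omega),
    card_isNonBacktracking_girth_add_four hG hg hm, liftCount_self, liftCount_add_four,
    show 2 * m + 4 = 2 * (m + 1) + 2 by ring, show 2 * m + 2 = 2 * (m + 1) by ring,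
    (liftCount_add_two c d (m + 1)).1]
  push_cast
  ring

open scoped Classical in
theorem card_closedWalks_eq_add (h : IsCompl U W) (n : ℕ)
    (P : (Σ v : V, G.Walk v v) → Prop) :
    #{p ∈ closedWalks G n | P p} =
      #{p ∈ closedWalks G n | p.1 ∈ U ∧ P p} + #{p ∈ closedWalks G n | p.1 ∈ W ∧ P p} := by
  rw [← card_filter_add_card_filter_not (fun p => p.1 ∈ U), filter_filter, filter_filter]
  simp only [← Set.mem_compl_iff, h.compl_eq, and_comm]

end GirthCounts

end BiregularCycles

/-! ### Assembling both sides of the bipartition -/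

open BiregularCycles Finset in
theorem mainTheorem5 {V : Type*} [Fintype V] [DecidableEq V] (G : SimpleGraph V)
    [DecidableRel G.Adj] (U W : Set V) (c d g : ℕ)
    (hG : BiregularCycles.IsBiregularBipartite G U W c d)
    (hgirth : G.egirth = (g : ℕ∞)) (hg : g + 4 < 2 * g) :
    ((BiregularCycles.numClosedWalksWithCycle G (g + 4) : ℕ) : ℝ) =
        ((g : ℝ) + 2) * (BiregularCycles.numCycles G (g + 2) : ℝ) * ((g : ℝ) + 4)
            * ((c : ℝ) + d - 2)
          + (g : ℝ) * (BiregularCycles.numCycles G g : ℝ)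
            * ((g : ℝ) * ((c : ℝ) + d - 2) ^ 2 + ((c : ℝ) + d) * ((c : ℝ) + d - 1))
          + (g : ℝ) * (BiregularCycles.numCycles G g : ℝ)
            * (2 * (Nat.choose (g / 2) 2 : ℝ) * (((c : ℝ) - 1) ^ 2 + ((d : ℝ) - 1) ^ 2)
              + 2 * ((g : ℝ) / 2) ^ 2 * ((c : ℝ) - 1) * ((d : ℝ) - 1))
          + (g : ℝ) * (BiregularCycles.numCycles G g : ℝ) * ((g : ℝ) / 2)
            * (((c : ℝ) + d) * ((c : ℝ) + d - 2))
          + (g : ℝ) * (BiregularCycles.numCycles G g : ℝ)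
            * (((g : ℝ) / 2 + 1) * ((c : ℝ) + d - 2) * ((c : ℝ) + d - 4)
              + ((c : ℝ) - 2) * (2 * (d : ℝ) - 1) + ((d : ℝ) - 2) * (2 * (c : ℝ) - 1)) ∧
    (BiregularCycles.numCycles G (g + 4) : ℝ) =
        ((∑ j : V, (G.isHermitian_adjMatrix ℝ).eigenvalues j ^ (g + 4))
          - (BiregularCycles.numClosedCycleFreeWalks G (g + 4) : ℝ)
          - (BiregularCycles.numClosedWalksWithCycle G (g + 4) : ℝ)) / (2 * ((g : ℝ) + 4)) := by
  classical
  obtain ⟨m, rfl⟩ : ∃ m, g = 2 * m := (even_of_egirth_eq hG hgirth).exists_two_nsmul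
  have hU := card_containsCycle_from hG hgirth (by omega)
  have hW := card_containsCycle_from hG.symm hgirth (by omega)
  have hcyc : #{p ∈ closedWalks G (2 * m + 4) | p.2.IsCycle} =
      2 * ((2 * m + 4) * numCycles G (2 * m + 4)) := by
    rw [card_closedWalks_eq_add hG.isCompl, card_cycles hG, card_cycles hG.symm]
    ring
  have hΨ : numClosedWalksWithCycle G (2 * m + 4) =
      #{p ∈ closedWalks G (2 * m + 4) | ¬ p.2.IsCycle ∧ ContainsCycle p.2} :=
    Nat.subtype_card _ fun p => by rw [mem_filter, mem_closedWalks]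
  have hΩ : numClosedCycleFreeWalks G (2 * m + 4) =
      #{p ∈ closedWalks G (2 * m + 4) | ¬ ContainsCycle p.2} :=
    Nat.subtype_card _ fun p => by rw [mem_filter, mem_closedWalks]
  have hall : #{p ∈ closedWalks G (2 * m + 4) | ContainsCycle p.2} +
      numClosedCycleFreeWalks G (2 * m + 4) = #(closedWalks G (2 * m + 4)) := by
    rw [hΩ, card_filter_add_card_filter_not]
  have hsplit : #{p ∈ closedWalks G (2 * m + 4) | ContainsCycle p.2} =
      2 * ((2 * m + 4) * numCycles G (2 * m + 4)) + numClosedWalksWithCycle G (2 * m + 4) := by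
    rw [← hcyc, hΨ, ← card_filter_add_card_filter_not (fun p => p.2.IsCycle), filter_filter,
      filter_filter]
    congr 2
    · refine filter_congr fun p _ => and_iff_right_of_imp fun h => ?_
      exact ⟨p.1, p.2, h, List.Subset.refl _⟩
    · simp only [and_comm]
  have hsides := card_closedWalks_eq_add (G := G) hG.isCompl (2 * m + 4)
    fun p => ContainsCycle p.2
  have hchoose : ((Nat.choose m 2 : ℕ) : ℝ) = m * (m - 1) / 2 := Nat.cast_choose_two ℝ m
  -- Closed walks containing a cycle are counted twice: as cycles plus `Ψ`, and by the side of the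
  -- initial vertex. The cycle terms of length `g + 4` then cancel, leaving `Ψ` in terms of shorter
  -- cycles.
  have key : 2 * ((2 * (m : ℝ) + 4) * numCycles G (2 * m + 4)) +
      numClosedWalksWithCycle G (2 * m + 4) =
        (#{p ∈ closedWalks G (2 * m + 4) | p.1 ∈ U ∧ ContainsCycle p.2} : ℝ) +
          #{p ∈ closedWalks G (2 * m + 4) | p.1 ∈ W ∧ ContainsCycle p.2} := by
    exact_mod_cast hsplit.symm.trans hsides
  rw [hU, hW] at key
  constructor
  · rw [show 2 * m / 2 = m by omega, hchoose]
    push_cast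
    linear_combination key
  · rw [sum_eigenvalues_pow_eq_card_closedWalks, eq_div_iff (by positivity), ← hall, hsplit]
    push_cast
    ring
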